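/- Throughout, $k,\ell\ge 0$ are natural numbers, words are finite sequences of letters, $|X|$ is the length of $X$, $1$ is the empty word, and $X\equiv Y$ means that $X$ and $Y$ are the same word. A *$(k,\ell)$-semigroup* is a semigroup with unit given by a finite alphabet $a_1,\dots,a_n$ and $k$ defining relations $A_i=1$ with $|A_i|\le\ell$ $(1\le i\le k)$; two words are equal in it if one is obtained from the other by finitely many insertions $XY\to XA_iY$ and deletions $XA_iY\to XY$. It is a *$(k,\ell)$-group* if every word is left and right invertible in it. The identity problem asks for an algorithm deciding whether two given words are equal. Words $X,Y$ *overlap* if $X\equiv MN$, $Y\equiv NL$ with $N$ and $ML$ non-empty. A *$(k,\ell)$-tuple* $R=\{V;C_1,\dots,C_s\}$ consists of a $(k,\ell)$-semigroup $V$ with relations $A_i=1$ and pairwise distinct non-empty words $C_1,\dots,C_s$ over its alphabet such that: no $C_i$ overlaps with any $C_j$ (including $i=j$); every $A_i$ is a (possibly empty) product $C_{i_1}\cdots C_{i_t}$; every $C_j$ occurs as a factor in such a product for some $A_i$; and the $(k,\ell)$-semigroup $\Gamma$ with generators $\beta_1,\dots,\beta_s$ and relations $\beta_{i_1}\cdots\beta_{i_t}=1$,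 obtained from the (unique) factorizations $A_i\equiv C_{i_1}\cdots C_{i_t}$, is a $(k,\ell)$-group. The *$c_i$-words* of $R$ are $C_i$ and all words obtained from it by finitely many steps $$h_1C_{p_1}\cdots C_{p_t}h_2\ \to\ h_1C_{q_1}\cdots C_{q_u}h_2\qquad(t,u\ge 0),$$ where $h_1,h_2$ are non-empty words, the length does not increase, and $\beta_{p_1}\cdots\beta_{p_t}=\beta_{q_1}\cdots\beta_{q_u}$ in $\Gamma$. The $c$-words are the $c_i$-words for all $i$. The tuple is *distinguished* if (I) every $c_i$-word has length $|C_i|$; (II) no word is both a $c_i$-word and a $c_j$-word with $i\ne j$; (III) no two $c$-words, equal or not, overlap. In a distinguished tuple, a word is *integral* if it is a product $A\equiv w_1\cdots w_m$ $(m\ge 0)$ of $c$-words; if $w_r$ is a $c_{i_r}$-word, put $f(A)=\beta_{i_1}\cdots\beta_{i_m}$ (this is well defined). Integral words $A,B$ are *equivalent* if $f(A)=f(B)$ in $\Gamma$. A *non-increasing replacement* is $XAY\to XBY$ with $A,B$ equivalent integral words and $|B|\le|A|$. Let $\mathfrak T(X)$ be the set of all words obtained from $X$ by finitely many (possibly zero)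 non-increasing replacements. **Theorem.** Let $k$ and $\ell$ be natural numbers. (a) If the identity problem is decidable in every $(k,\ell)$-group, then the identity problem is decidable in the semigroup of any distinguished $(k,\ell)$-tuple; moreover, one algorithm does this for all distinguished $(k,\ell)$-tuples, taking the tuple and the two words as input. (b) For every distinguished $(k,\ell)$-tuple with semigroup $V$, every set $\mathfrak T(X)$ is finite, and two words $X,Y$ are equal in $V$ if and only if $\mathfrak T(X)\cap\mathfrak T(Y)\neq\emptyset$. -/

import Mathlib

namespace Makanin

/-- A `(k, ℓ)`-semigroup: a finite alphabet `a_1, …, a_n` and `k` defining relations `A_i = 1`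
with `|A_i| ≤ ℓ`.  Words are lists of letters, the empty word is `[]`. -/
structure KLSemigroup (k ℓ : ℕ) where
  n : ℕ
  rel : Fin k → List (Fin n)
  length_le : ∀ i, (rel i).length ≤ ℓ

namespace KLSemigroup

variable {k ℓ : ℕ}

/-- Elementary transformations `XY → X A_i Y`, `X A_i Y → XY` and `X → X`. -/
inductive ElemTrans (S : KLSemigroup k ℓ) : List (Fin S.n) → List (Fin S.n) → Prop
  | refl (X : List (Fin S.n)) : ElemTrans S X X
  | insertion (X Y : List (Fin S.n)) (i : Fin k) : ElemTrans S (X ++ Y) (X ++ S.rel i ++ Y)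
  | deletion (X Y : List (Fin S.n)) (i : Fin k) : ElemTrans S (X ++ S.rel i ++ Y) (X ++ Y)

/-- `X = Y` in the semigroup: some finite sequence of elementary transformations leads from `X`
to `Y`. -/
def Equal (S : KLSemigroup k ℓ) (X Y : List (Fin S.n)) : Prop :=
  Relation.ReflTransGen S.ElemTrans X Y

/-- A `(k, ℓ)`-group: a `(k, ℓ)`-semigroup in which every word is left and right invertible. -/
def IsGroup (S : KLSemigroup k ℓ) : Prop :=
  ∀ X : List (Fin S.n), (∃ Y, S.Equal (Y ++ X) []) ∧ (∃ Y, S.Equal (X ++ Y) [])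

/-- The identity problem of the given semigroup is algorithmically decidable. -/
def IdentityProblemDecidable (S : KLSemigroup k ℓ) : Prop :=
  ComputablePred fun p : List (Fin S.n) × List (Fin S.n) => S.Equal p.1 p.2

end KLSemigroup

/-- `X` and `Y` overlap: `X = MN` and `Y = NL` with `N` and `ML` non-empty. -/
def Overlap {α : Type*} (X Y : List α) : Prop :=
  ∃ M N L : List α, X = M ++ N ∧ Y = N ++ L ∧ N ≠ [] ∧ M ++ L ≠ []

/-- `C_1, …, C_s` is a list of `B`-words of the semigroup `S`.  Here `m.flatMap C` is the product
`C_{i_1} C_{i_2} ⋯ C_{i_t}` for `m = [i_1, …, i_t]`. -/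
structure IsBWords {k ℓ : ℕ} (S : KLSemigroup k ℓ) {s : ℕ} (C : Fin s → List (Fin S.n)) :
    Prop where
  ne_nil : ∀ j, C j ≠ []
  injective : Function.Injective C
  not_overlap : ∀ i j, ¬ Overlap (C i) (C j)
  factor : ∀ i, ∃ m : List (Fin s), S.rel i = m.flatMap C
  occurs : ∀ j, ∃ i, ∃ m : List (Fin s), S.rel i = m.flatMap C ∧ j ∈ m

namespace IsBWords

variable {k ℓ : ℕ} {S : KLSemigroup k ℓ} {s : ℕ} {C : Fin s → List (Fin S.n)}

/-- A factorization of a word into `B`-words is unique, so that the choice made in `gamma` below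
is no choice. -/
theorem factor_unique (h : IsBWords S C) :
    ∀ m m' : List (Fin s), m.flatMap C = m'.flatMap C → m = m' := by
  intro m
  induction m with
  | nil =>
    intro m' e
    cases m' with
    | nil => rfl
    | cons j m' =>
      simp only [List.flatMap_nil, List.flatMap_cons] at e
      exact absurd (List.append_eq_nil_iff.1 e.symm).1 (h.ne_nil j)
  | cons i m ih =>
    intro m' e
    cases m' with
    | nil =>
      simp only [List.flatMap_nil, List.flatMap_cons] at e
      exact absurd (List.append_eq_nil_iff.1 e).1 (h.ne_nil i)
    | cons j m' =>
      simp only [List.flatMap_cons] at e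
      have key : C i = C j := by
        rcases List.append_eq_append_iff.1 e with ⟨t, ht, -⟩ | ⟨t, ht, -⟩
        · by_contra hne
          refine h.not_overlap i j ⟨[], C i, t, by simp, ht, h.ne_nil i, ?_⟩
          rintro h0
          exact hne (by simp_all)
        · by_contra hne
          refine h.not_overlap j i ⟨[], C j, t, by simp, ht, h.ne_nil j, ?_⟩
          rintro h0
          exact hne (by simp_all)
      obtain rfl := h.injective key
      rw [ih m' (List.append_cancel_left e)]

theorem length_le_flatMap (h : IsBWords S C) (m : List (Fin s)) :
    m.length ≤ (m.flatMap C).length := by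
  induction m with
  | nil => simp
  | cons i m ih =>
    have := List.length_pos_of_ne_nil (h.ne_nil i)
    simp only [List.flatMap_cons, List.length_append, List.length_cons]
    omega

/-- The `(k, ℓ)`-semigroup with generators `β_1, …, β_s` and relations `M_i = 1`, where `M_i` is
obtained from `A_i` by replacing the `B`-words by the corresponding letters `β_j`. -/
noncomputable def gamma (h : IsBWords S C) : KLSemigroup k ℓ where
  n := s
  rel i := (h.factor i).choose
  length_le i := by
    refine (h.length_le_flatMap _).trans ?_
    rw [← (h.factor i).choose_spec]
    exact S.length_le i

end IsBWords

/-- A `(k, ℓ)`-tuple: a `(k, ℓ)`-semigroup together with a list of `C`-words of it, that is, a list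
of `B`-words whose associated semigroup `Γ` is a `(k, ℓ)`-group. -/
structure KLTuple (k ℓ : ℕ) where
  S : KLSemigroup k ℓ
  s : ℕ
  C : Fin s → List (Fin S.n)
  isBWords : IsBWords S C
  isGroup : isBWords.gamma.IsGroup

namespace KLTuple

variable {k ℓ : ℕ}

/-- The words over the alphabet of the semigroup of the tuple. -/
abbrev Word (R : KLTuple k ℓ) : Type := List (Fin R.S.n)

/-- `β_{p_1} ⋯ β_{p_t} = β_{q_1} ⋯ β_{q_u}` in the group `Γ` of the tuple. -/
def GroupEqual (R : KLTuple k ℓ) (p q : List (Fin R.s)) : Prop :=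
  R.isBWords.gamma.Equal p q

/-- One step of the generating operation:
`h₁ C_{p_1} ⋯ C_{p_t} h₂` is replaced by `h₁ C_{q_1} ⋯ C_{q_u} h₂`. -/
def GenStep (R : KLTuple k ℓ) (U V : R.Word) : Prop :=
  ∃ (h₁ h₂ : R.Word) (p q : List (Fin R.s)), h₁ ≠ [] ∧ h₂ ≠ [] ∧
    U = h₁ ++ p.flatMap R.C ++ h₂ ∧ V = h₁ ++ q.flatMap R.C ++ h₂ ∧
    V.length ≤ U.length ∧ R.GroupEqual p q

/-- The set of `c_i`-words: all words obtained from `C_i` by finitely many steps of the generating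
operation. -/
def cWords (R : KLTuple k ℓ) (i : Fin R.s) : Set R.Word :=
  {U | Relation.ReflTransGen R.GenStep (R.C i) U}

/-- The tuple has the three properties: all `c_i`-words are as long as `C_i`; no word is both a
`c_i`-word and a `c_j`-word with `i ≠ j`; no two `c`-words (equal or not) overlap. -/
structure Distinguished (R : KLTuple k ℓ) : Prop where
  length_eq : ∀ i, ∀ U ∈ R.cWords i, U.length = (R.C i).length
  disjoint : ∀ i j, i ≠ j → ∀ U, ¬ (U ∈ R.cWords i ∧ U ∈ R.cWords j)
  not_overlap : ∀ i j, ∀ U ∈ R.cWords i, ∀ V ∈ R.cWords j, ¬ Overlap U V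

/-- `A` is an integral word with image `p` in the group: `A` is a product of `c`-words, the
successive factors being `c_i`-words for the successive entries `i` of `p`.  For a distinguished
tuple `p` is determined by `A`; it is the value `f(A)`. -/
def IntegralImage (R : KLTuple k ℓ) (A : R.Word) (p : List (Fin R.s)) : Prop :=
  ∃ L : List R.Word, List.Forall₂ (fun i c => c ∈ R.cWords i) p L ∧ A = L.flatten

/-- `A` and `B` are integral words whose images are equal in the group of the tuple. -/
def IntegralEquiv (R : KLTuple k ℓ) (A B : R.Word) : Prop :=
  ∃ p q, R.IntegralImage A p ∧ R.IntegralImage B q ∧ R.GroupEqual p q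

/-- A non-increasing replacement `XAY → XBY`: `A` and `B` are equivalent integral words and
`|B| ≤ |A|`. -/
def NonincReplacement (R : KLTuple k ℓ) (U V : R.Word) : Prop :=
  ∃ X A B Y : R.Word, U = X ++ A ++ Y ∧ V = X ++ B ++ Y ∧
    R.IntegralEquiv A B ∧ B.length ≤ A.length

/-- The set `𝔗(A)` of words obtained from `A` by finitely many non-increasing replacements. -/
def descendants (R : KLTuple k ℓ) (A : R.Word) : Set R.Word :=
  {B | Relation.ReflTransGen R.NonincReplacement A B}

/-- A word as a list of natural numbers, as an input for an algorithm. -/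
def codeWord {n : ℕ} (X : List (Fin n)) : List ℕ := X.map Fin.val

/-- A tuple as finite data, as an input for an algorithm: the size of the alphabet, the list of the
left-hand sides of the defining relations, and the list of `C`-words. -/
def code (R : KLTuple k ℓ) : ℕ × List (List ℕ) × List (List ℕ) :=
  (R.S.n, List.ofFn fun i => codeWord (R.S.rel i), List.ofFn fun j => codeWord (R.C j))

end KLTuple

end Makanin

/-! Non-increasing replacements preserve equality in $V$, and deleting a relator is one of them, so
(b) reduces to confluence. This is the one-step diamond property `Distinguished.diamond`, fed to
`church_rosser`. Since $c$-words do not overlap, two integral parts of a word can lie in only three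
ways (`Distinguished.positions`). If they are disjoint, the replacements commute. If one lies
strictly inside a $c$-word of the other, replacing it yields a $c$-word of the same index and
length, so the outer replacement is still available. If they are aligned along $c$-word boundaries,
both results replace a common integral word by equivalent ones, and the longer result can be
replaced by the shorter. Finiteness holds because lengths never grow over a finite alphabet.

For (a), `Distinguished.mem_descendants_iff` eliminates $c$-words: replacements between products of
the $C_j$ generate the same descendants. Below a length bound these form a finite rewriting system,
computable once equality in $\Gamma$ can be decided. By `s_le`, $\Gamma$ has at most $k\ell$
generators, so only finitely many groups arise and their separate decision procedures merge into
one. -/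

namespace Makanin

/-! ### Equality in a semigroup is a congruence. -/

namespace KLSemigroup

variable {k ℓ : ℕ} {S : KLSemigroup k ℓ}

theorem ElemTrans.symm {X Y : List (Fin S.n)} (h : S.ElemTrans X Y) : S.ElemTrans Y X := by
  cases h with
  | refl => exact .refl _
  | insertion X Y i => exact .deletion X Y i
  | deletion X Y i => exact .insertion X Y i

theorem ElemTrans.context {X Y : List (Fin S.n)} (h : S.ElemTrans X Y) (P Q : List (Fin S.n)) :
    S.ElemTrans (P ++ X ++ Q) (P ++ Y ++ Q) := by
  cases h with
  | refl => exact .refl _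
  | insertion X Y i => simpa using ElemTrans.insertion (S := S) (P ++ X) (Y ++ Q) i
  | deletion X Y i => simpa using ElemTrans.deletion (S := S) (P ++ X) (Y ++ Q) i

theorem Equal.refl (X : List (Fin S.n)) : S.Equal X X := Relation.ReflTransGen.refl

theorem Equal.trans {X Y Z : List (Fin S.n)} (h : S.Equal X Y) (h' : S.Equal Y Z) :
    S.Equal X Z := Relation.ReflTransGen.trans h h'

theorem Equal.symm {X Y : List (Fin S.n)} (h : S.Equal X Y) : S.Equal Y X := by
  induction h with
  | refl => exact .refl _
  | tail _ h ih => exact Relation.ReflTransGen.head h.symm ih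

theorem Equal.context {X Y : List (Fin S.n)} (h : S.Equal X Y) (P Q : List (Fin S.n)) :
    S.Equal (P ++ X ++ Q) (P ++ Y ++ Q) :=
  Relation.ReflTransGen.lift (fun Z => P ++ Z ++ Q) (fun _ _ h => h.context P Q) _ _ h

theorem Equal.append {X X' Y Y' : List (Fin S.n)} (h : S.Equal X X') (h' : S.Equal Y Y') :
    S.Equal (X ++ Y) (X' ++ Y') := by
  have h₁ := h.context [] Y
  have h₂ := h'.context X' []
  simp only [List.nil_append, List.append_nil] at h₁ h₂
  exact h₁.trans h₂

theorem equal_rel_nil (i : Fin k) : S.Equal (S.rel i) [] := by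
  have h := ElemTrans.deletion (S := S) [] [] i
  simp only [List.nil_append, List.append_nil] at h
  exact .single h

end KLSemigroup

open KLSemigroup Relation

namespace IsBWords

variable {k ℓ : ℕ} {S : KLSemigroup k ℓ} {s : ℕ} {C : Fin s → List (Fin S.n)}

theorem flatMap_gamma_rel (h : IsBWords S C) (i : Fin k) :
    List.flatMap C (h.gamma.rel i) = S.rel i := (h.factor i).choose_spec.symm

/-- Equality in `Γ` of words in the `β_j` implies equality of the corresponding products. -/
theorem equal_flatMap (h : IsBWords S C) {p q : List (Fin s)} (e : h.gamma.Equal p q) :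
    S.Equal (p.flatMap C) (q.flatMap C) := by
  have insertion : ∀ (X Y m : List (Fin s)) (i : Fin k), m.flatMap C = S.rel i →
      S.ElemTrans ((X ++ Y).flatMap C) ((X ++ m ++ Y).flatMap C) := by
    intro X Y m i hm
    simp only [List.flatMap_append, hm]
    exact .insertion _ _ i
  have step : ∀ a b, h.gamma.ElemTrans a b →
      S.ElemTrans (List.flatMap C a) (List.flatMap C b) := by
    intro a b hab
    cases hab with
    | refl => exact .refl _
    | insertion X Y i => exact insertion X Y _ i (h.flatMap_gamma_rel i)
    | deletion X Y i => exact (insertion X Y _ i (h.flatMap_gamma_rel i)).symm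
  exact ReflTransGen.lift (fun m : List (Fin s) => m.flatMap C) step _ _ e

end IsBWords

/-! ### Generating steps, integral words and replacements. -/

namespace KLTuple

variable {k ℓ : ℕ} {R : KLTuple k ℓ}

theorem GroupEqual.symm {p q : List (Fin R.s)} (h : R.GroupEqual p q) : R.GroupEqual q p :=
  Equal.symm h

theorem GroupEqual.trans {p q r : List (Fin R.s)} (h : R.GroupEqual p q) (h' : R.GroupEqual q r) :
    R.GroupEqual p r := Equal.trans h h'

theorem GroupEqual.refl (p : List (Fin R.s)) : R.GroupEqual p p := Equal.refl _

theorem GroupEqual.append {p q p' q' : List (Fin R.s)} (h : R.GroupEqual p q)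
    (h' : R.GroupEqual p' q') : R.GroupEqual (p ++ p') (q ++ q') := Equal.append h h'

theorem equal_flatMap {p q : List (Fin R.s)} (e : R.GroupEqual p q) :
    R.S.Equal (p.flatMap R.C) (q.flatMap R.C) := R.isBWords.equal_flatMap e

theorem GenStep.context {U V : R.Word} (h : R.GenStep U V) (P Q : R.Word) :
    R.GenStep (P ++ U ++ Q) (P ++ V ++ Q) := by
  obtain ⟨h₁, h₂, p, q, n₁, n₂, rfl, rfl, hl, hg⟩ := h
  refine ⟨P ++ h₁, h₂ ++ Q, p, q, by simp [n₁], by simp [n₂], by simp, by simp, ?_, hg⟩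
  simp only [List.length_append] at hl ⊢
  omega

/-- The length condition is the only asymmetric clause of a generating step. -/
theorem GenStep.symm {U V : R.Word} (h : R.GenStep U V) (hl : V.length = U.length) :
    R.GenStep V U := by
  obtain ⟨h₁, h₂, p, q, n₁, n₂, e, e', -, hg⟩ := h
  exact ⟨h₁, h₂, q, p, n₁, n₂, e', e, hl.ge, hg.symm⟩

theorem GenStep.equal {U V : R.Word} (h : R.GenStep U V) : R.S.Equal U V := by
  obtain ⟨h₁, h₂, p, q, n₁, n₂, rfl, rfl, hl, hg⟩ := h
  exact (equal_flatMap hg).context h₁ h₂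

theorem equal_of_mem_cWords {i : Fin R.s} {U : R.Word} (h : U ∈ R.cWords i) :
    R.S.Equal (R.C i) U := by
  induction h with
  | refl => exact .refl _
  | tail _ h ih => exact ih.trans h.equal

theorem IntegralImage.nil : R.IntegralImage [] [] := ⟨[], .nil, rfl⟩

theorem IntegralImage.cons {i : Fin R.s} {w A : R.Word} {p : List (Fin R.s)}
    (hw : w ∈ R.cWords i) (h : R.IntegralImage A p) : R.IntegralImage (w ++ A) (i :: p) := by
  obtain ⟨L, hL, rfl⟩ := h
  exact ⟨w :: L, .cons hw hL, rfl⟩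

theorem IntegralImage.append {A B : R.Word} {p q : List (Fin R.s)}
    (h : R.IntegralImage A p) (h' : R.IntegralImage B q) : R.IntegralImage (A ++ B) (p ++ q) := by
  obtain ⟨L, hL, rfl⟩ := h
  obtain ⟨M, hM, rfl⟩ := h'
  exact ⟨L ++ M, List.rel_append hL hM, by simp⟩

/-- Induction over the factorization of an integral word into `c`-words. -/
theorem IntegralImage.induction
    {motive : (A : R.Word) → (p : List (Fin R.s)) → R.IntegralImage A p → Prop}
    (nil : motive [] [] .nil)
    (cons : ∀ i w A p (hw : w ∈ R.cWords i) (hA : R.IntegralImage A p), motive A p hA →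
      motive (w ++ A) (i :: p) (hA.cons hw))
    {A : R.Word} {p : List (Fin R.s)} (h : R.IntegralImage A p) : motive A p h := by
  obtain ⟨L, hL, rfl⟩ := h
  induction hL with
  | nil => exact nil
  | cons hw hL ih => exact cons _ _ _ _ hw ⟨_, hL, rfl⟩ ih

theorem integralImage_flatMap (p : List (Fin R.s)) : R.IntegralImage (p.flatMap R.C) p := by
  induction p with
  | nil => exact .nil
  | cons i p ih => exact ih.cons ReflTransGen.refl

theorem IntegralImage.equal {A : R.Word} {p : List (Fin R.s)} (h : R.IntegralImage A p) :
    R.S.Equal (p.flatMap R.C) A := by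
  induction h using IntegralImage.induction with
  | nil => exact .refl _
  | cons i w A p hw _ ih => exact (equal_of_mem_cWords hw).append ih

theorem NonincReplacement.equal {U V : R.Word} (h : R.NonincReplacement U V) :
    R.S.Equal U V := by
  obtain ⟨X, A, B, Y, rfl, rfl, ⟨p, q, hA, hB, hpq⟩, -⟩ := h
  exact ((hA.equal.symm.trans (equal_flatMap hpq)).trans hB.equal).context X Y

theorem NonincReplacement.length_le {U V : R.Word} (h : R.NonincReplacement U V) :
    V.length ≤ U.length := by
  obtain ⟨X, A, B, Y, rfl, rfl, -, h⟩ := h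
  simp only [List.length_append]
  omega

theorem NonincReplacement.refl (U : R.Word) : R.NonincReplacement U U :=
  ⟨[], [], [], U, rfl, rfl, ⟨[], [], .nil, .nil, .refl _⟩, le_rfl⟩

/-- A relator of $V$ is the product of $C$-words spelled by a relator of $\Gamma$, so it is integral
with trivial image, like the empty word. -/
theorem nonincReplacement_deletion (X Y : R.Word) (i : Fin k) :
    R.NonincReplacement (X ++ R.S.rel i ++ Y) (X ++ Y) := by
  refine ⟨X, R.S.rel i, [], Y, rfl, by simp, ⟨R.isBWords.gamma.rel i, [], ?_, .nil, ?_⟩, by simp⟩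
  · rw [← R.isBWords.flatMap_gamma_rel i]
    exact integralImage_flatMap (R := R) _
  · exact equal_rel_nil (S := R.isBWords.gamma) i

/-! ### Relative positions of integral words, and confluence. -/

namespace Distinguished

variable (hR : R.Distinguished)

include hR

theorem ne_nil_of_mem_cWords {i : Fin R.s} {w : R.Word} (hw : w ∈ R.cWords i) : w ≠ [] := by
  have := hR.length_eq i w hw
  have := List.length_pos_of_ne_nil (R.isBWords.ne_nil i)
  exact List.ne_nil_of_length_pos (by omega)

theorem length_eq_of_integralImage {A : R.Word} {p : List (Fin R.s)} (h : R.IntegralImage A p) :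
    A.length = (p.flatMap R.C).length := by
  induction h using IntegralImage.induction with
  | nil => rfl
  | cons i w A p hw _ ih =>
    simp only [List.flatMap_cons, List.length_append, ih, hR.length_eq i w hw]

/-- Reversibility of the generating steps between `c`-words. -/
theorem genStep_reverse {i : Fin R.s} {w : R.Word} (hw : w ∈ R.cWords i) :
    ReflTransGen R.GenStep w (R.C i) := by
  suffices ∀ U, ReflTransGen R.GenStep (R.C i) U → ReflTransGen R.GenStep U (R.C i) from
    this w hw
  intro U hU
  induction hU with
  | refl => exact .refl
  | @tail U V hU hUV ih =>
    refine .head (hUV.symm ?_) ih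
    rw [hR.length_eq i U hU, hR.length_eq i V (hU.tail hUV)]

/-- Each factor is exchanged with its $C_i$ by steps inside that factor, so the context may be
empty. The left context varies in the induction because it absorbs the factors already exchanged. -/
theorem genStep_integral {A : R.Word} {p : List (Fin R.s)} (h : R.IntegralImage A p)
    (h₁ h₂ : R.Word) :
    ReflTransGen R.GenStep (h₁ ++ A ++ h₂) (h₁ ++ p.flatMap R.C ++ h₂) ∧
      ReflTransGen R.GenStep (h₁ ++ p.flatMap R.C ++ h₂) (h₁ ++ A ++ h₂) := by
  induction h using IntegralImage.induction generalizing h₁ with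
  | nil => exact ⟨.refl, .refl⟩
  | cons i w A p hw _ ih =>
    have lift : ∀ {U V : R.Word}, ReflTransGen R.GenStep U V →
        ReflTransGen R.GenStep (h₁ ++ U ++ (A ++ h₂)) (h₁ ++ V ++ (A ++ h₂)) :=
      fun h => ReflTransGen.lift (fun Z => h₁ ++ Z ++ (A ++ h₂)) (fun _ _ h => h.context _ _) _ _ h
    have a := lift (hR.genStep_reverse hw)
    have b := lift hw
    obtain ⟨c, d⟩ := ih (h₁ ++ R.C i)
    simp only [List.flatMap_cons, List.append_assoc] at a b c d ⊢
    exact ⟨a.trans c, d.trans b⟩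

/-- A non-increasing replacement strictly inside a `c_i`-word gives a `c_i`-word. -/
theorem mem_cWords_of_nested {i : Fin R.s} {A B h₁ h₂ : R.Word} (n₁ : h₁ ≠ []) (n₂ : h₂ ≠ [])
    (hw : h₁ ++ A ++ h₂ ∈ R.cWords i) (h : R.IntegralEquiv A B) (hl : B.length ≤ A.length) :
    h₁ ++ B ++ h₂ ∈ R.cWords i := by
  obtain ⟨p, q, hA, hB, hpq⟩ := h
  have step : R.GenStep (h₁ ++ p.flatMap R.C ++ h₂) (h₁ ++ q.flatMap R.C ++ h₂) := by
    refine ⟨h₁, h₂, p, q, n₁, n₂, rfl, rfl, ?_, hpq⟩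
    rw [hR.length_eq_of_integralImage hA, hR.length_eq_of_integralImage hB] at hl
    simp only [List.length_append]
    omega
  -- Pass from `A` to the product of $C$-words, make one generating step there, and come back to
  -- `B`.
  exact ((ReflTransGen.trans hw (hR.genStep_integral hA h₁ h₂).1).tail step).trans
    (hR.genStep_integral hB h₁ h₂).2

/-- An integral word that starts properly inside a `c`-word ends properly inside it. -/
theorem nested_of_append_eq {i : Fin R.s} {A : R.Word} {p : List (Fin R.s)}
    (hA : R.IntegralImage A p) {T r Z Q : R.Word} (hT : T ≠ []) (hr : r ≠ [])
    (hw : T ++ r ∈ R.cWords i) (e : r ++ Z = A ++ Q) :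
    ∃ h₂, h₂ ≠ [] ∧ r = A ++ h₂ ∧ Q = h₂ ++ Z := by
  induction hA using IntegralImage.induction generalizing T r with
  | nil => exact ⟨r, hr, rfl, e.symm⟩
  | cons j v A p hv _ ih =>
    rw [List.append_assoc] at e
    -- If the factor `v` reached the end of `r`, then `T ++ r` and `v` would overlap in `r`; `T ≠
    -- []` makes the overlap proper even when `v = r`.
    have key : ∀ t, v ≠ r ++ t := by
      rintro t rfl
      exact hR.not_overlap i j _ hw _ hv ⟨T, r, t, rfl, rfl, hr, by simp [hT]⟩
    rcases List.append_eq_append_iff.1 e with ⟨t, ht, -⟩ | ⟨r', rfl, e'⟩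
    · exact absurd ht (key t)
    · have hr' : r' ≠ [] := by
        rintro rfl
        exact key [] (by simp)
      obtain ⟨h₂, n₂, rfl, hQ⟩ := ih (T := T ++ v) (by simp [hT]) hr' (by simpa using hw) e'.symm
      exact ⟨h₂, n₂, by simp, hQ⟩

/-- Of two integral words that start at the same place, one is an initial part of the other. -/
theorem aligned_of_append_eq {A A' : R.Word} {p p' : List (Fin R.s)} (hA : R.IntegralImage A p)
    (hA' : R.IntegralImage A' p') {Q Q' : R.Word} (e : A ++ Q = A' ++ Q') :
    (∃ B q, R.IntegralImage B q ∧ A' = A ++ B ∧ p' = p ++ q) ∨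
      (∃ B q, R.IntegralImage B q ∧ A = A' ++ B ∧ p = p' ++ q) := by
  induction hA using IntegralImage.induction generalizing A' p' with
  | nil => exact .inl ⟨A', p', hA', rfl, rfl⟩
  | cons i w A p hw hA ih =>
    induction hA' using IntegralImage.induction with
    | nil => exact .inr ⟨_, _, hA.cons hw, rfl, rfl⟩
    | cons j v A' p' hv hA' _ =>
      -- Otherwise one $c$-word is a proper prefix of the other, which is an overlap with $M$ empty.
      have hwv : w = v := by
        simp only [List.append_assoc] at e
        rcases List.append_eq_append_iff.1 e with ⟨t, ht, -⟩ | ⟨t, ht, -⟩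
        · by_contra hne
          refine hR.not_overlap i j w hw v hv
            ⟨[], w, t, rfl, ht, hR.ne_nil_of_mem_cWords hw, fun h => hne ?_⟩
          simp_all
        · by_contra hne
          refine hR.not_overlap j i v hv w hw
            ⟨[], v, t, rfl, ht, hR.ne_nil_of_mem_cWords hv, fun h => hne ?_⟩
          simp_all
      subst hwv
      have hij : i = j := by
        by_contra hne
        exact hR.disjoint i j hne w ⟨hw, hv⟩
      subst hij
      simp only [List.append_assoc] at e
      rcases ih hA' (List.append_cancel_left e) with ⟨B, q, hB, rfl, rfl⟩ | ⟨B, q, hB, rfl, rfl⟩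
      · exact .inl ⟨B, q, hB, by simp, rfl⟩
      · exact .inr ⟨B, q, hB, by simp, rfl⟩

/-- The relative positions of two integral words of which the second starts after the first:
they are disjoint, or the second is nested in a `c`-word of the first, or the second starts at a
boundary between `c`-words of the first. -/
theorem positions {A A' : R.Word} {p p' : List (Fin R.s)} (hA : R.IntegralImage A p)
    (hA' : R.IntegralImage A' p') {T Q Q' : R.Word} (e : A ++ Q = T ++ A' ++ Q') :
    (∃ T', T = A ++ T' ∧ Q = T' ++ A' ++ Q') ∨
    (∃ A₁ p₁ A₂ p₂ i h₁ h₂, R.IntegralImage A₁ p₁ ∧ R.IntegralImage A₂ p₂ ∧ h₁ ≠ [] ∧ h₂ ≠ [] ∧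
      h₁ ++ A' ++ h₂ ∈ R.cWords i ∧ p = p₁ ++ i :: p₂ ∧ T = A₁ ++ h₁ ∧ Q' = h₂ ++ A₂ ++ Q ∧
      A = A₁ ++ (h₁ ++ A' ++ h₂) ++ A₂) ∨
    (∃ A₁ p₁ A₂ p₂, R.IntegralImage A₁ p₁ ∧ R.IntegralImage A₂ p₂ ∧ p = p₁ ++ p₂ ∧ T = A₁ ∧
      A = A₁ ++ A₂ ∧ A₂ ++ Q = A' ++ Q') := by
  induction hA using IntegralImage.induction generalizing T with
  | nil => exact .inl ⟨T, rfl, e⟩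
  | cons i w A p hw hA ih =>
    by_cases hT : T = []
    · subst hT
      exact .inr (.inr ⟨[], [], _, _, .nil, hA.cons hw, rfl, rfl, rfl, by simpa using e⟩)
    have e₀ : w ++ (A ++ Q) = T ++ (A' ++ Q') := by simpa using e
    -- Either the second word starts at or after the end of `w`, and the induction proceeds, or it
    -- starts strictly inside `w` and is nested there.
    by_cases hlen : ∃ T', T = w ++ T'
    · obtain ⟨T', rfl⟩ := hlen
      rcases ih (T := T') (by simpa using e) with ⟨T'', rfl, hQ⟩ |
        ⟨A₁, p₁, A₂, p₂, j, h₁, h₂, i₁, i₂, n₁, n₂, hc, rfl, rfl, rfl, rfl⟩ |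
        ⟨A₁, p₁, A₂, p₂, i₁, i₂, rfl, rfl, rfl, h⟩
      · exact .inl ⟨T'', by simp, hQ⟩
      · exact .inr (.inl ⟨w ++ A₁, i :: p₁, A₂, p₂, j, h₁, h₂, i₁.cons hw, i₂, n₁, n₂, hc,
          by simp, by simp, by simp, by simp⟩)
      · exact .inr (.inr ⟨w ++ T', i :: p₁, A₂, p₂, i₁.cons hw, i₂, by simp, rfl, by simp, h⟩)
    · rcases List.append_eq_append_iff.1 e₀ with ⟨t, ht, -⟩ | ⟨r, rfl, e'⟩
      · exact absurd ⟨t, ht⟩ hlen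
      · have hr : r ≠ [] := by
          rintro rfl
          exact hlen ⟨[], by simp⟩
        obtain ⟨h₂, n₂, rfl, hQ⟩ := hR.nested_of_append_eq hA' hT hr hw e'.symm
        exact .inr (.inl ⟨[], [], A, p, i, T, h₂, .nil, hA, hT, n₂, by simpa using hw, rfl, rfl,
          by simpa using hQ, by simp⟩)

omit hR in
/-- Two replacements of integral parts of one integral word can be joined. -/
theorem join_of_integralEquiv {P Q B B' : R.Word} {p p' : List (Fin R.s)}
    (hB : R.IntegralImage B p) (hB' : R.IntegralImage B' p') (h : R.GroupEqual p p') :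
    ∃ W, R.NonincReplacement (P ++ B ++ Q) W ∧ R.NonincReplacement (P ++ B' ++ Q) W := by
  rcases le_total B.length B'.length with hl | hl
  · exact ⟨_, .refl _, P, B', B, Q, rfl, rfl, ⟨p', p, hB', hB, h.symm⟩, hl⟩
  · exact ⟨_, ⟨P, B, B', Q, rfl, rfl, ⟨p, p', hB, hB', h⟩, hl⟩, .refl _⟩

/-- The case of the diamond property in which `A` starts no later than `A'`; the three positions are
treated separately. -/
theorem diamond_of_append {P T A B Q A' B' Q' : R.Word} (h : R.IntegralEquiv A B)
    (hl : B.length ≤ A.length) (h' : R.IntegralEquiv A' B') (hl' : B'.length ≤ A'.length)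
    (e : A ++ Q = T ++ A' ++ Q') :
    ∃ W, R.NonincReplacement (P ++ B ++ Q) W ∧
      R.NonincReplacement (P ++ T ++ B' ++ Q') W := by
  obtain ⟨p, q, hA, hB, hpq⟩ := h
  obtain ⟨p', q', hA', hB', hpq'⟩ := h'
  rcases hR.positions hA hA' e with ⟨T', rfl, rfl⟩ |
    ⟨A₁, p₁, A₂, p₂, i, h₁, h₂, i₁, i₂, n₁, n₂, hc, rfl, rfl, rfl, rfl⟩ |
    ⟨A₁, p₁, A₂, p₂, i₁, i₂, rfl, rfl, rfl, e'⟩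
  · exact ⟨P ++ B ++ T' ++ B' ++ Q',
      ⟨P ++ B ++ T', A', B', Q', by simp, by simp, ⟨p', q', hA', hB', hpq'⟩, hl'⟩,
      ⟨P, A, B, T' ++ B' ++ Q', by simp, by simp, ⟨p, q, hA, hB, hpq⟩, hl⟩⟩
  · have hc' := hR.mem_cWords_of_nested n₁ n₂ hc ⟨p', q', hA', hB', hpq'⟩ hl'
    have := hR.length_eq _ _ hc
    have := hR.length_eq _ _ hc'
    -- The nested replacement changes neither the image nor the length of the outer integral word,
    -- so that word can still be replaced by `B`.
    refine ⟨_, .refl _, P, A₁ ++ (h₁ ++ B' ++ h₂) ++ A₂, B, Q, by simp, rfl,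
      ⟨p₁ ++ i :: p₂, q, ?_, hB, hpq⟩, ?_⟩
    · simpa using i₁.append (i₂.cons hc')
    · simp only [List.length_append] at *
      omega
  · rcases hR.aligned_of_append_eq i₂ hA' e' with ⟨D, d, hD, rfl, rfl⟩ | ⟨D, d, hD, rfl, rfl⟩
    · have hQ : Q = D ++ Q' := by simpa using e'
      subst hQ
      -- `B ++ D` and `A₁ ++ B'` are both equivalent to `A₁ ++ A₂ ++ D`, the span of the two
      -- replaced words.
      have := join_of_integralEquiv (P := P) (Q := Q') (hB.append hD) (i₁.append hB')
        ((hpq.symm.append (.refl d)).trans (by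
          rw [List.append_assoc]
          exact (GroupEqual.refl _).append hpq'))
      simpa using this
    · have hQ : Q' = D ++ Q := by simpa using e'.symm
      subst hQ
      have := join_of_integralEquiv (P := P) (Q := Q) hB ((i₁.append hB').append hD)
        (hpq.symm.trans (by
          rw [List.append_assoc]
          exact (GroupEqual.refl _).append (hpq'.append (.refl _))))
      simpa using this

theorem diamond {X Y Z : R.Word} (h : R.NonincReplacement X Y) (h' : R.NonincReplacement X Z) :
    ∃ W, R.NonincReplacement Y W ∧ R.NonincReplacement Z W := by
  obtain ⟨P, A, B, Q, rfl, rfl, hAB, hl⟩ := h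
  obtain ⟨P', A', B', Q', e, rfl, hAB', hl'⟩ := h'
  simp only [List.append_assoc] at e
  rcases List.append_eq_append_iff.1 e with ⟨T, rfl, e'⟩ | ⟨T, rfl, e'⟩
  · exact hR.diamond_of_append hAB hl hAB' hl' (by simpa using e')
  · obtain ⟨W, h, h'⟩ := hR.diamond_of_append (P := P') hAB' hl' hAB hl (by simpa using e')
    exact ⟨W, h', h⟩

theorem join_of_descendants {X Y Z : R.Word} (h : Y ∈ R.descendants X)
    (h' : Z ∈ R.descendants X) : ∃ W, W ∈ R.descendants Y ∧ W ∈ R.descendants Z := by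
  refine church_rosser (fun a b c hab hac => ?_) h h'
  obtain ⟨W, hb, hc⟩ := hR.diamond hab hac
  exact ⟨W, .single hb, .single hc⟩

theorem equal_iff {X Y : R.Word} :
    R.S.Equal X Y ↔ (R.descendants X ∩ R.descendants Y).Nonempty := by
  constructor
  · intro h
    induction h with
    | refl => exact ⟨X, .refl, .refl⟩
    | @tail Y Z _ hYZ ih =>
      obtain ⟨W, hX, hY⟩ := ih
      cases hYZ with
      | refl => exact ⟨W, hX, hY⟩
      | insertion U V i =>
        exact ⟨W, hX, .head (nonincReplacement_deletion U V i) hY⟩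
      | deletion U V i =>
        -- Only a deletion needs confluence: `Y` has both `W` and the shortened word among its
        -- descendants. For an insertion, the inverse deletion prolongs the chain at its start.
        obtain ⟨W', h, h'⟩ := hR.join_of_descendants hY
          (ReflTransGen.single (nonincReplacement_deletion U V i))
        exact ⟨W', ReflTransGen.trans hX h, h'⟩
  · rintro ⟨W, hX, hY⟩
    have key : ∀ {U V}, V ∈ R.descendants U → R.S.Equal U V := by
      intro U V h
      induction h with
      | refl => exact .refl _
      | tail _ h ih => exact ih.trans h.equal
    exact (key hX).trans (key hY).symm

end Distinguished

theorem length_le_of_mem_descendants {X Y : R.Word} (h : Y ∈ R.descendants X) :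
    Y.length ≤ X.length := by
  induction h with
  | refl => exact le_rfl
  | tail _ h ih => exact h.length_le.trans ih

theorem finite_descendants (X : R.Word) : (R.descendants X).Finite :=
  (List.finite_length_le (Fin R.S.n) X.length).subset fun _ => length_le_of_mem_descendants

end KLTuple

end Makanin

/-! ### Elimination of $c$-words from the description of descendants. -/

namespace Makanin

open KLSemigroup Relation

namespace KLTuple

variable {k ℓ : ℕ} {R : KLTuple k ℓ}

/-- A non-increasing replacement of a product of `C`-words by a product of `C`-words. -/
def BasicStep (R : KLTuple k ℓ) (U V : R.Word) : Prop :=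
  ∃ (P Q : R.Word) (p q : List (Fin R.s)), U = P ++ p.flatMap R.C ++ Q ∧
    V = P ++ q.flatMap R.C ++ Q ∧ V.length ≤ U.length ∧ R.GroupEqual p q

theorem BasicStep.length_le {U V : R.Word} (h : R.BasicStep U V) : V.length ≤ U.length := by
  obtain ⟨_, _, _, _, _, _, h, _⟩ := h
  exact h

theorem BasicStep.nonincReplacement {U V : R.Word} (h : R.BasicStep U V) :
    R.NonincReplacement U V := by
  obtain ⟨P, Q, p, q, rfl, rfl, hl, hg⟩ := h
  refine ⟨P, _, _, Q, rfl, rfl, ⟨p, q, integralImage_flatMap p, integralImage_flatMap q, hg⟩, ?_⟩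
  simp only [List.length_append] at hl
  omega

theorem GenStep.basicStep {U V : R.Word} (h : R.GenStep U V) : R.BasicStep U V := by
  obtain ⟨h₁, h₂, p, q, -, -, h⟩ := h
  exact ⟨h₁, h₂, p, q, h⟩

theorem BasicStep.context {U V : R.Word} (h : R.BasicStep U V) (P Q : R.Word) :
    R.BasicStep (P ++ U ++ Q) (P ++ V ++ Q) := by
  obtain ⟨h₁, h₂, p, q, rfl, rfl, hl, hg⟩ := h
  refine ⟨P ++ h₁, h₂ ++ Q, p, q, by simp, by simp, ?_, hg⟩
  simp only [List.length_append] at hl ⊢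
  omega

theorem basicSteps_context {U V : R.Word} (h : ReflTransGen R.BasicStep U V) (P Q : R.Word) :
    ReflTransGen R.BasicStep (P ++ U ++ Q) (P ++ V ++ Q) :=
  ReflTransGen.lift (fun Z => P ++ Z ++ Q) (fun _ _ h => h.context P Q) _ _ h

theorem basicSteps_append {U V U' V' : R.Word} (h : ReflTransGen R.BasicStep U V)
    (h' : ReflTransGen R.BasicStep U' V') : ReflTransGen R.BasicStep (U ++ U') (V ++ V') := by
  have h₁ := basicSteps_context h [] U'
  have h₂ := basicSteps_context h' V []
  simp only [List.nil_append, List.append_nil] at h₁ h₂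
  exact h₁.trans h₂

theorem basicSteps_of_genSteps {U V : R.Word} (h : ReflTransGen R.GenStep U V) :
    ReflTransGen R.BasicStep U V :=
  ReflTransGen.mono (fun _ _ h => h.basicStep) _ _ h

namespace Distinguished

theorem basicSteps_integral (hR : R.Distinguished) {A : R.Word} {p : List (Fin R.s)}
    (h : R.IntegralImage A p) :
    ReflTransGen R.BasicStep A (p.flatMap R.C) ∧ ReflTransGen R.BasicStep (p.flatMap R.C) A := by
  induction h using IntegralImage.induction with
  | nil => exact ⟨.refl, .refl⟩
  | cons i w A p hw _ ih =>
    exact ⟨basicSteps_append (basicSteps_of_genSteps (hR.genStep_reverse hw)) ih.1,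
      basicSteps_append (basicSteps_of_genSteps hw) ih.2⟩

theorem basicSteps_of_nonincReplacement (hR : R.Distinguished) {U V : R.Word}
    (h : R.NonincReplacement U V) : ReflTransGen R.BasicStep U V := by
  obtain ⟨X, A, B, Y, rfl, rfl, ⟨p, q, hA, hB, hpq⟩, hl⟩ := h
  refine basicSteps_context ?_ X Y
  refine ((hR.basicSteps_integral hA).1.tail ⟨[], [], p, q, by simp, by simp, ?_, hpq⟩).trans
    (hR.basicSteps_integral hB).2
  rwa [← hR.length_eq_of_integralImage hA, ← hR.length_eq_of_integralImage hB]

/-- An algorithm then needs only the words $C_j$ and equality in $\Gamma$, and no enumeration of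
$c$-words. -/
theorem mem_descendants_iff (hR : R.Distinguished) {X Y : R.Word} :
    Y ∈ R.descendants X ↔ ReflTransGen R.BasicStep X Y :=
  ⟨fun h => ReflTransGen.lift' id (fun _ _ h => hR.basicSteps_of_nonincReplacement h) _ _ h,
    fun h => ReflTransGen.mono (fun _ _ h => h.nonincReplacement) _ _ h⟩

end Distinguished

end KLTuple

end Makanin

/-! ### Computability of list operations and of bounded rewriting. -/

namespace Makanin

open Relation

section Primrec

variable {α β : Type*} [Primcodable α] [Primcodable β]

theorem primrecPred_exists_mem {f : α → List β} {r : α → β → Prop} (hf : Primrec f)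
    (hr : PrimrecPred fun p : α × β => r p.1 p.2) : PrimrecPred fun a => ∃ b ∈ f a, r a b :=
  (PrimrecRel.exists_mem_list (R := fun b a => r a b)
    (hr.comp (Primrec.pair Primrec.snd Primrec.fst))).comp hf Primrec.id

theorem primrecPred_forall_mem {f : α → List β} {r : α → β → Prop} (hf : Primrec f)
    (hr : PrimrecPred fun p : α × β => r p.1 p.2) : PrimrecPred fun a => ∀ b ∈ f a, r a b :=
  (PrimrecRel.forall_mem_list (R := fun b a => r a b)
    (hr.comp (Primrec.pair Primrec.snd Primrec.fst))).comp hf Primrec.id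

theorem primrecPred_mem {f : α → List β} {g : α → β} (hf : Primrec f) (hg : Primrec g) :
    PrimrecPred fun a => g a ∈ f a :=
  (primrecPred_exists_mem (r := fun a b => b = g a) hf
    (Primrec.eq.comp Primrec.snd (hg.comp Primrec.fst))).of_eq fun a => by simp

theorem primrecPred_imp {p q : α → Prop} (hp : PrimrecPred p) (hq : PrimrecPred q) :
    PrimrecPred fun a => p a → q a :=
  (hp.not.or hq).of_eq fun a => by tauto

theorem primrec_sublists' : Primrec (List.sublists' : List α → List (List α)) := by
  have h : Primrec fun l : List α =>
      l.foldr (fun a r => r ++ r.map (List.cons a)) [[]] := by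
    refine Primrec.list_foldr Primrec.id (Primrec.const _)
      (h := fun _ (p : α × List (List α)) => p.2 ++ p.2.map (List.cons p.1)) ?_
    have hr : Primrec fun p : List α × α × List (List α) => p.2.2 :=
      Primrec.snd.comp Primrec.snd
    refine Primrec.list_append.comp hr (Primrec.list_map hr ?_)
    exact Primrec.list_cons.comp (Primrec.fst.comp (Primrec.snd.comp Primrec.fst)) Primrec.snd
  refine h.of_eq fun l => ?_
  induction l with
  | nil => rfl
  | cons a l ih => simp [ih, List.sublists'_cons]

/-- Needed for a test that is merely computable, as the decision procedures for groups are; the list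
is scanned by recursion on the index. -/
theorem computable_filter {f : α → List β} {g : α → β → Bool} (hf : Computable f)
    (hg : Computable₂ g) : Computable fun a => (f a).filter (g a) := by
  have h : Computable fun a => Nat.rec (motive := fun _ => List β) []
      (fun i acc => Option.casesOn (motive := fun _ => List β) (f a)[i]? acc
        fun b => bif g a b then acc ++ [b] else acc) (f a).length := by
    refine Computable.nat_rec (h := fun a (p : ℕ × List β) =>
        Option.casesOn (motive := fun _ => List β) (f a)[p.1]? p.2 fun b =>
          bif g a b then p.2 ++ [b] else p.2)
      (Computable.list_length.comp hf) (Computable.const _) ?_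
    have hacc : Computable fun q : (α × ℕ × List β) × β => q.1.2.2 :=
      Computable.snd.comp (Computable.snd.comp Computable.fst)
    refine Computable.option_casesOn
      (Computable.list_getElem?.comp (hf.comp Computable.fst)
        (Computable.fst.comp Computable.snd))
      (Computable.snd.comp Computable.snd) (Computable.cond ?_ ?_ hacc)
    · exact hg.comp (Computable.fst.comp Computable.fst) Computable.snd
    · exact Computable.list_concat.comp hacc Computable.snd
  refine h.of_eq fun a => ?_
  suffices ∀ m ≤ (f a).length, Nat.rec (motive := fun _ => List β) []
      (fun i acc => Option.casesOn (motive := fun _ => List β) (f a)[i]? acc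
        fun b => bif g a b then acc ++ [b] else acc) m = ((f a).take m).filter (g a) by
    rw [this _ le_rfl, List.take_length]
  intro m hm
  induction m with
  | zero => simp
  | succ m ih =>
    have hlt : m < (f a).length := hm
    rw [List.take_add_one, List.filter_append, ← ih hlt.le]
    simp only [List.getElem?_eq_getElem hlt, Option.toList_some]
    cases hb : g a (f a)[m] <;> simp [hb]

end Primrec

section Reachability

variable {α : Type*}

/-- `z` belongs to every sublist of `W` that contains `x` and is closed in `W` under `r`. -/
def ReachIn (r : α → α → Prop) (W : List α) (x z : α) : Prop :=
  ∀ S ∈ W.sublists', x ∈ S → (∀ u ∈ S, ∀ v ∈ W, r u v → v ∈ S) → z ∈ S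

/-- The reachable elements of `W` form the least closed sublist containing `x`. Quantifying over the
finitely many sublists avoids an unbounded search for a path. -/
theorem reachIn_iff {r : α → α → Prop} {W : List α} {x z : α} (hx : x ∈ W) :
    ReachIn r W x z ↔ ReflTransGen (fun u v => v ∈ W ∧ r u v) x z := by
  classical
  constructor
  · intro h
    have := h (W.filter fun v => ReflTransGen (fun u v => v ∈ W ∧ r u v) x v)
      (List.mem_sublists'.2 List.filter_sublist) (by simp [hx, ReflTransGen.refl]) (by
        intro u hu v hv huv
        simp only [List.mem_filter, decide_eq_true_eq] at hu ⊢
        exact ⟨hv, hu.2.tail ⟨hv, huv⟩⟩)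
    simpa using (List.mem_filter.1 this).2
  · intro h S hS hxS hcl
    induction h with
    | refl => exact hxS
    | tail _ h ih => exact hcl _ ih _ h.1 h.2

end Reachability

/-- All words of length at most `N` in the letters `0, …, n - 1`. -/
def words (n : ℕ) : ℕ → List (List ℕ)
  | 0 => [[]]
  | N + 1 => [] :: (words n N).flatMap fun w => (List.range n).map fun a => a :: w

theorem primrec_words : Primrec₂ words := by
  have h : Primrec fun x : ℕ × ℕ => Nat.rec (motive := fun _ => List (List ℕ)) [[]]
      (fun _ L => [] :: L.flatMap fun w => (List.range x.1).map fun a => a :: w) x.2 := by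
    refine Primrec.nat_rec' (h := fun (x : ℕ × ℕ) p =>
      [] :: p.2.flatMap fun w => (List.range x.1).map fun a => a :: w)
      Primrec.snd (Primrec.const _) ?_
    refine Primrec.list_cons.comp (Primrec.const _)
      (Primrec.list_flatMap (Primrec.snd.comp Primrec.snd) ?_)
    refine Primrec.list_map (Primrec.list_range.comp
      (Primrec.fst.comp (Primrec.fst.comp Primrec.fst))) ?_
    exact Primrec.list_cons.comp Primrec.snd (Primrec.snd.comp Primrec.fst)
  refine h.of_eq fun x => ?_
  obtain ⟨n, N⟩ := x
  induction N with
  | zero => rfl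
  | succ N ih => simp only [words, ← ih]

theorem mem_words {n N : ℕ} {w : List ℕ} :
    w ∈ words n N ↔ ∃ v : List (Fin n), v.length ≤ N ∧ KLTuple.codeWord v = w := by
  induction N generalizing w with
  | zero =>
    simp only [words, List.mem_singleton]
    constructor
    · rintro rfl
      exact ⟨[], le_rfl, rfl⟩
    · rintro ⟨v, hv, rfl⟩
      obtain rfl := List.length_eq_zero_iff.1 (Nat.le_zero.1 hv)
      rfl
  | succ N ih =>
    simp only [words, List.mem_cons, List.mem_flatMap, List.mem_map, List.mem_range]
    constructor
    · rintro (rfl | ⟨u, hu, a, ha, rfl⟩)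
      · exact ⟨[], Nat.zero_le _, rfl⟩
      · obtain ⟨v, hv, rfl⟩ := ih.1 hu
        exact ⟨⟨a, ha⟩ :: v, by simpa using hv, rfl⟩
    · rintro ⟨v, hv, rfl⟩
      cases v with
      | nil => exact .inl rfl
      | cons a v =>
        exact .inr ⟨_, ih.2 ⟨v, by simpa using hv, rfl⟩, a, a.2, rfl⟩

/-- The product of the listed words that are selected by the entries of `p`. -/
def listProd (Cs : List (List ℕ)) (p : List ℕ) : List ℕ := p.flatMap fun j => Cs.getD j []

theorem primrec_listProd : Primrec₂ listProd :=
  Primrec.list_flatMap Primrec.snd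
    ((Primrec.list_getD []).comp (Primrec.fst.comp Primrec.fst) Primrec.snd)

/-- One rewriting step with a rule from the list `T`, with context words taken from the list `W`,
that does not increase the length. -/
def RewriteStep (W : List (List ℕ)) (T : List (List ℕ × List ℕ)) (u v : List ℕ) : Prop :=
  ∃ t ∈ T, ∃ x ∈ W, ∃ y ∈ W, u = x ++ t.1 ++ y ∧ v = x ++ t.2 ++ y ∧ v.length ≤ u.length

section

variable {α : Type*} [Primcodable α] {W : α → List (List ℕ)} {T : α → List (List ℕ × List ℕ)}
  {u v : α → List ℕ}

theorem primrecPred_rewriteStep (hW : Primrec W) (hT : Primrec T) (hu : Primrec u)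
    (hv : Primrec v) : PrimrecPred fun a => RewriteStep (W a) (T a) (u a) (v a) := by
  refine primrecPred_exists_mem hT (primrecPred_exists_mem (hW.comp .fst)
    (primrecPred_exists_mem (hW.comp (.comp .fst .fst)) ?_))
  have ha : Primrec fun p : ((α × List ℕ × List ℕ) × List ℕ) × List ℕ => p.1.1.1 :=
    .comp .fst (.comp .fst .fst)
  have ht : Primrec fun p : ((α × List ℕ × List ℕ) × List ℕ) × List ℕ => p.1.1.2 :=
    .comp .snd (.comp .fst .fst)
  have hx : Primrec fun p : ((α × List ℕ × List ℕ) × List ℕ) × List ℕ => p.1.2 :=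
    .comp .snd .fst
  refine .and ?_ (.and ?_ ?_)
  · exact Primrec.eq.comp (hu.comp ha) (Primrec.list_append.comp
      (Primrec.list_append.comp hx (Primrec.fst.comp ht)) .snd)
  · exact Primrec.eq.comp (hv.comp ha) (Primrec.list_append.comp
      (Primrec.list_append.comp hx (Primrec.snd.comp ht)) .snd)
  · exact Primrec.nat_le.comp (Primrec.list_length.comp (hv.comp ha))
      (Primrec.list_length.comp (hu.comp ha))

theorem primrecPred_reachIn (hW : Primrec W) (hT : Primrec T) (hu : Primrec u)
    (hv : Primrec v) :
    PrimrecPred fun a => ReachIn (RewriteStep (W a) (T a)) (W a) (u a) (v a) := by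
  refine primrecPred_forall_mem (primrec_sublists'.comp hW) ?_
  refine primrecPred_imp (primrecPred_mem .snd (hu.comp .fst)) (primrecPred_imp ?_
    (primrecPred_mem .snd (hv.comp .fst)))
  refine primrecPred_forall_mem .snd (primrecPred_forall_mem (hW.comp (.comp .fst .fst)) ?_)
  have ha : Primrec fun p : ((α × List (List ℕ)) × List ℕ) × List ℕ => p.1.1.1 :=
    .comp .fst (.comp .fst .fst)
  exact primrecPred_imp
    (primrecPred_rewriteStep (hW.comp ha) (hT.comp ha) (.comp .snd .fst) .snd)
    (primrecPred_mem (.comp .snd (.comp .fst .fst)) .snd)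

end

/-- Some word of the list `W` is reachable in `W` from both given words by rewriting with `T`. -/
def Joinable (W : List (List ℕ)) (T : List (List ℕ × List ℕ)) (u v : List ℕ) : Prop :=
  ∃ z ∈ W, ReachIn (RewriteStep W T) W u z ∧ ReachIn (RewriteStep W T) W v z

theorem primrecPred_joinable : PrimrecPred
    fun a : (List (List ℕ) × List (List ℕ × List ℕ)) × List ℕ × List ℕ =>
      Joinable a.1.1 a.1.2 a.2.1 a.2.2 := by
  refine primrecPred_exists_mem (.comp .fst .fst) ?_
  exact .and
    (primrecPred_reachIn (.comp .fst (.comp .fst .fst)) (.comp .snd (.comp .fst .fst))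
      (.comp .fst (.comp .snd .fst)) .snd)
    (primrecPred_reachIn (.comp .fst (.comp .fst .fst)) (.comp .snd (.comp .fst .fst))
      (.comp .snd (.comp .snd .fst)) .snd)

end Makanin

/-! ### Codes of words and groups, and the rule table. -/

namespace Makanin

open Relation

namespace KLTuple

theorem codeWord_injective {n : ℕ} : Function.Injective (codeWord (n := n)) :=
  List.map_injective_iff.2 Fin.val_injective

theorem codeWord_append {n : ℕ} (X Y : List (Fin n)) :
    codeWord (X ++ Y) = codeWord X ++ codeWord Y := List.map_append

theorem length_codeWord {n : ℕ} (X : List (Fin n)) : (codeWord X).length = X.length :=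
  List.length_map _

theorem listProd_codeWord {n s : ℕ} (C : Fin s → List (Fin n)) (p : List (Fin s)) :
    listProd (List.ofFn fun j => codeWord (C j)) (codeWord p) = codeWord (p.flatMap C) := by
  induction p with
  | nil => rfl
  | cons i p ih =>
    have : listProd (List.ofFn fun j => codeWord (C j)) (codeWord (i :: p)) =
        (List.ofFn fun j => codeWord (C j)).getD i [] ++
          listProd (List.ofFn fun j => codeWord (C j)) (codeWord p) := rfl
    rw [this, ih, List.flatMap_cons, codeWord_append]
    -- Entries of a coded word are in range, so the default `[]` is never used.
    simp [List.getD_eq_getElem?_getD]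

end KLTuple

open KLTuple

namespace KLSemigroup

variable {k ℓ : ℕ}

/-- A `(k, ℓ)`-semigroup as finite data: the size of the alphabet and the list of relators. -/
def code (G : KLSemigroup k ℓ) : ℕ × List (List ℕ) :=
  (G.n, List.ofFn fun i => codeWord (G.rel i))

theorem code_injective : Function.Injective (code (k := k) (ℓ := ℓ)) := by
  rintro ⟨n, rel, h⟩ ⟨n', rel', h'⟩ e
  simp only [code, Prod.mk.injEq] at e
  obtain ⟨rfl, e⟩ := e
  have : rel = rel' := by
    funext i
    exact codeWord_injective (congrFun (List.ofFn_injective e) i)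
  subst this
  rfl

theorem finite_setOf_n_le (B : ℕ) : {G : KLSemigroup k ℓ | G.n ≤ B}.Finite := by
  have hfin : ∀ n, Finite {l : List (Fin n) // l.length ≤ ℓ} := fun n =>
    (List.finite_length_le (Fin n) ℓ).to_subtype
  refine (Set.finite_range (fun x : Σ n : Fin (B + 1), Fin k → {l : List (Fin n) // l.length ≤ ℓ} =>
    (⟨x.1, fun i => (x.2 i).1, fun i => (x.2 i).2⟩ : KLSemigroup k ℓ))).subset ?_
  intro G hG
  exact ⟨⟨⟨G.n, Nat.lt_succ_of_le hG⟩, fun i => ⟨G.rel i, G.length_le i⟩⟩, rfl⟩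

/-- The word over `Fin n` with a given code. -/
def decodeWord (n : ℕ) (w : List ℕ) : List (Fin n) := w.filterMap Encodable.decode

theorem primrec_decodeWord (n : ℕ) : Primrec (decodeWord n) :=
  Primrec.listFilterMap Primrec.id (Primrec.decode.comp Primrec.snd)

theorem decodeWord_codeWord {n : ℕ} (X : List (Fin n)) : decodeWord n (codeWord X) = X := by
  have : ∀ i : Fin n, Encodable.decode (α := Fin n) i.val = some i := fun i =>
    Encodable.encodek i
  simp [decodeWord, codeWord, List.filterMap_map, this]

/-- Finitely many procedures can be hard-wired and selected by comparing codes, so decidability of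
each group separately suffices. -/
theorem exists_decision_of_finite {𝒢 : Set (KLSemigroup k ℓ)} (h𝒢 : 𝒢.Finite)
    (h : ∀ G ∈ 𝒢, G.IdentityProblemDecidable) :
    ∃ O : (ℕ × List (List ℕ)) × List ℕ × List ℕ → Bool, Computable O ∧
      ∀ G ∈ 𝒢, ∀ p q, O (G.code, codeWord p, codeWord q) = true ↔ G.Equal p q := by
  induction 𝒢, h𝒢 using Set.Finite.induction_on with
  | empty => exact ⟨fun _ => false, Computable.const _, by simp⟩
  | @insert G 𝒢 _ _ ih =>
    obtain ⟨O, hO, hcorrect⟩ := ih fun G' hG' => h G' (Set.mem_insert_of_mem _ hG')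
    obtain ⟨_, hdec⟩ := h G (Set.mem_insert _ _)
    have hc : Computable fun x : (ℕ × List (List ℕ)) × List ℕ × List ℕ => decide (x.1 = G.code) :=
      (Primrec.eq.decide.comp Primrec.fst (Primrec.const _)).to_comp
    have hd : Computable fun x : (ℕ × List (List ℕ)) × List ℕ × List ℕ =>
        (decodeWord G.n x.2.1, decodeWord G.n x.2.2) :=
      (Primrec.pair ((primrec_decodeWord _).comp (.comp .fst .snd))
        ((primrec_decodeWord _).comp (.comp .snd .snd))).to_comp
    refine ⟨_, Computable.cond hc (hdec.comp hd) hO, ?_⟩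
    intro G' hG' p q
    by_cases e : G'.code = G.code
    · obtain rfl := code_injective e
      simp [decodeWord_codeWord]
    · have hmem : G' ∈ 𝒢 := by
        rcases Set.mem_insert_iff.1 hG' with rfl | h
        · exact absurd rfl e
        · exact h
      simpa [e] using hcorrect G' hmem p q

end KLSemigroup

/-- The code of the group of a tuple with `C`-words `Cs` and relators `rels`. -/
def gammaCode (rels Cs : List (List ℕ)) : ℕ × List (List ℕ) :=
  (Cs.length, rels.map fun r => ((words Cs.length r.length).filter
    fun p => decide (listProd Cs p = r)).headI)

theorem primrec_gammaCode : Primrec₂ gammaCode := by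
  refine Primrec.pair (Primrec.list_length.comp .snd) (Primrec.list_map .fst ?_)
  have hr : PrimrecRel fun (p : List ℕ) (x : (List (List ℕ) × List (List ℕ)) × List ℕ) =>
      listProd x.1.2 p = x.2 :=
    Primrec.eq.comp (primrec_listProd.comp (.comp .snd (.comp .fst .snd)) .fst) (.comp .snd .snd)
  have hw : Primrec fun x : (List (List ℕ) × List (List ℕ)) × List ℕ =>
      words x.1.2.length x.2.length :=
    primrec_words.comp (Primrec.list_length.comp (.comp .snd .fst))
      (Primrec.list_length.comp .snd)
  exact Primrec.list_headI.comp (hr.listFilter.comp hw .id)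

/-- The pairs of words of length at most `N` over `0, …, s - 1`. -/
def wordPairs (s N : ℕ) : List (List ℕ × List ℕ) :=
  (words s N).flatMap fun p => (words s N).map fun q => (p, q)

theorem primrec_wordPairs : Primrec₂ wordPairs :=
  Primrec.list_flatMap primrec_words
    (Primrec.list_map (primrec_words.comp (.comp .fst .fst) (.comp .snd .fst)) (Primrec.pair (.comp .snd .fst) .snd))

theorem mem_wordPairs {s N : ℕ} {x : List ℕ × List ℕ} :
    x ∈ wordPairs s N ↔ x.1 ∈ words s N ∧ x.2 ∈ words s N := by
  obtain ⟨a, b⟩ := x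
  simp only [wordPairs, List.mem_flatMap, List.mem_map, Prod.mk.injEq]
  constructor
  · rintro ⟨p, hp, q, hq, rfl, rfl⟩
    exact ⟨hp, hq⟩
  · rintro ⟨ha, hb⟩
    exact ⟨a, ha, b, hb, rfl, rfl⟩

/-- The rewriting rules of length at most `N` given by a decision procedure `O` for groups. -/
def ruleTable (O : (ℕ × List (List ℕ)) × List ℕ × List ℕ → Bool) (rels Cs : List (List ℕ))
    (N : ℕ) : List (List ℕ × List ℕ) :=
  ((wordPairs Cs.length N).filter fun t => O (gammaCode rels Cs, t)).map
    fun t => (listProd Cs t.1, listProd Cs t.2)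

theorem computable_ruleTable {O : (ℕ × List (List ℕ)) × List ℕ × List ℕ → Bool}
    (hO : Computable O) : Computable fun x : (List (List ℕ) × List (List ℕ)) × ℕ =>
      ruleTable O x.1.1 x.1.2 x.2 := by
  have hp : Computable fun x : (List (List ℕ) × List (List ℕ)) × ℕ =>
      wordPairs x.1.2.length x.2 :=
    (primrec_wordPairs.comp (Primrec.list_length.comp (.comp .snd .fst)) .snd).to_comp
  have hc : Primrec fun y : ((List (List ℕ) × List (List ℕ)) × ℕ) × List ℕ × List ℕ =>
      gammaCode y.1.1.1 y.1.1.2 :=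
    primrec_gammaCode.comp (.comp .fst (.comp .fst .fst)) (.comp .snd (.comp .fst .fst))
  have hg : Computable fun y : ((List (List ℕ) × List (List ℕ)) × ℕ) × List ℕ × List ℕ =>
      O (gammaCode y.1.1.1 y.1.1.2, y.2) := hO.comp (hc.to_comp.pair Computable.snd)
  have hf : Computable fun x : (List (List ℕ) × List (List ℕ)) × ℕ =>
      (wordPairs x.1.2.length x.2).filter fun t => O (gammaCode x.1.1 x.1.2, t) := by
    have := computable_filter
      (f := fun x : (List (List ℕ) × List (List ℕ)) × ℕ => wordPairs x.1.2.length x.2)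
      (g := fun x t => O (gammaCode x.1.1 x.1.2, t)) hp (Computable₂.mk hg)
    exact this
  have hm : Primrec₂ fun (Cs : List (List ℕ)) (L : List (List ℕ × List ℕ)) =>
      L.map fun t => (listProd Cs t.1, listProd Cs t.2) :=
    Primrec.list_map .snd (Primrec.pair (primrec_listProd.comp (.comp .fst .fst) (.comp .fst .snd))
      (primrec_listProd.comp (.comp .fst .fst) (.comp .snd .snd)))
  exact hm.to_comp.comp (Computable.snd.comp Computable.fst) hf

/-- The two words of the input are joinable by the rules of its tuple. -/
def DecidedEqual (O : (ℕ × List (List ℕ)) × List ℕ × List ℕ → Bool)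
    (x : (ℕ × List (List ℕ) × List (List ℕ)) × List ℕ × List ℕ) : Prop :=
  Joinable (words x.1.1 (x.2.1.length + x.2.2.length))
    (ruleTable O x.1.2.1 x.1.2.2 (x.2.1.length + x.2.2.length)) x.2.1 x.2.2

theorem computablePred_decidedEqual {O : (ℕ × List (List ℕ)) × List ℕ × List ℕ → Bool}
    (hO : Computable O) : ComputablePred (DecidedEqual O) := by
  obtain ⟨_, h⟩ := primrecPred_joinable.computablePred
  have hN : Primrec fun x : (ℕ × List (List ℕ) × List (List ℕ)) × List ℕ × List ℕ =>
      x.2.1.length + x.2.2.length :=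
    Primrec.nat_add.comp (Primrec.list_length.comp (.comp .fst .snd))
      (Primrec.list_length.comp (.comp .snd .snd))
  have hW := (primrec_words.comp (.comp .fst .fst) hN).to_comp
  have hT := (computable_ruleTable hO).comp
    (Primrec.pair (.comp .snd .fst) hN).to_comp
  have := h.comp (Computable.pair (Computable.pair hW hT) Computable.snd)
  exact ⟨_, this⟩

/-! ### Correctness of the algorithm. -/

namespace KLTuple

variable {k ℓ : ℕ} (R : KLTuple k ℓ)

/-- Factorization into $C$-words is unique, so the search finds exactly the relator chosen in
`gamma`. As the $C$-words are non-empty, a factorization has at most as many factors as the relator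
has letters. -/
theorem gammaCode_eq :
    gammaCode (List.ofFn fun i => codeWord (R.S.rel i)) (List.ofFn fun j => codeWord (R.C j)) =
      R.isBWords.gamma.code := by
  have hrel : ∀ i, ((words R.s (codeWord (R.S.rel i)).length).filter fun p =>
      decide (listProd (List.ofFn fun j => codeWord (R.C j)) p = codeWord (R.S.rel i))).headI =
        codeWord (R.isBWords.gamma.rel i) := by
    intro i
    set L := (words R.s (codeWord (R.S.rel i)).length).filter fun p =>
      decide (listProd (List.ofFn fun j => codeWord (R.C j)) p = codeWord (R.S.rel i)) with hL
    have hmem : ∀ p, p ∈ L ↔ p = codeWord (R.isBWords.gamma.rel i) := by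
      intro p
      simp only [hL, List.mem_filter, decide_eq_true_eq, mem_words]
      constructor
      · rintro ⟨⟨v, -, rfl⟩, h⟩
        rw [listProd_codeWord, ← R.isBWords.flatMap_gamma_rel i] at h
        exact congrArg codeWord (R.isBWords.factor_unique _ _ (codeWord_injective h))
      · rintro rfl
        refine ⟨⟨R.isBWords.gamma.rel i, ?_, rfl⟩, ?_⟩
        · rw [length_codeWord, ← R.isBWords.flatMap_gamma_rel i]
          exact R.isBWords.length_le_flatMap _
        · exact (listProd_codeWord R.C _).trans
            (congrArg _ (R.isBWords.flatMap_gamma_rel i))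
    cases hc : L with
    | nil =>
      have := (hmem _).2 rfl
      simp [hc] at this
    | cons a l => exact (hmem a).1 (by simp [hc])
  simp only [gammaCode, KLSemigroup.code, List.length_ofFn, List.map_ofFn, Function.comp_def, hrel]
  rfl

/-- Each generator of $\Gamma$ occurs in one of its $k$ relators, and these have length at most
$\ell$. -/
theorem s_le : R.s ≤ k * ℓ := by
  have hsub : (Finset.univ : Finset (Fin R.s)) ⊆
      Finset.univ.biUnion fun i : Fin k => List.toFinset (α := Fin R.s) (R.isBWords.gamma.rel i) := by
    intro j _
    obtain ⟨i, m, hm, hj⟩ := R.isBWords.occurs j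
    rw [← R.isBWords.flatMap_gamma_rel i] at hm
    obtain rfl := R.isBWords.factor_unique _ _ hm
    exact Finset.mem_biUnion.2 ⟨i, Finset.mem_univ i, List.mem_toFinset.2 hj⟩
  calc R.s = (Finset.univ : Finset (Fin R.s)).card := by simp
    _ ≤ _ := Finset.card_le_card hsub
    _ ≤ (Finset.univ : Finset (Fin k)).card * ℓ :=
      Finset.card_biUnion_le_card_mul _ _ _ fun i _ =>
        (List.toFinset_card_le _).trans (R.isBWords.gamma.length_le i)
    _ = k * ℓ := by simp

variable {R} {O : (ℕ × List (List ℕ)) × List ℕ × List ℕ → Bool}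

theorem mem_ruleTable (hO : ∀ p q, O (R.isBWords.gamma.code, codeWord p, codeWord q) = true ↔
      R.isBWords.gamma.Equal p q) {N : ℕ} {t : List ℕ × List ℕ} :
    t ∈ ruleTable O (List.ofFn fun i => codeWord (R.S.rel i))
        (List.ofFn fun j => codeWord (R.C j)) N ↔
      ∃ p q : List (Fin R.s), p.length ≤ N ∧ q.length ≤ N ∧ R.GroupEqual p q ∧
        t = (codeWord (p.flatMap R.C), codeWord (q.flatMap R.C)) := by
  simp only [ruleTable, gammaCode_eq, List.length_ofFn, List.mem_map, List.mem_filter,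
    mem_wordPairs, mem_words]
  constructor
  · rintro ⟨⟨_, _⟩, ⟨⟨⟨p, hp, rfl⟩, q, hq, rfl⟩, h⟩, rfl⟩
    exact ⟨p, q, hp, hq, (hO p q).1 h, by simp only [listProd_codeWord]⟩
  · rintro ⟨p, q, hp, hq, h, rfl⟩
    exact ⟨(codeWord p, codeWord q), ⟨⟨⟨p, hp, rfl⟩, q, hq, rfl⟩, (hO p q).2 h⟩,
      by simp only [listProd_codeWord]⟩

/-- Cutting everything off at `N` loses nothing: contexts are factors of `U`, and `p`, `q` are no
longer than the products they spell, which lie in words of length at most `N`. -/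
theorem rewriteStep_codeWord_iff
    (hO : ∀ p q, O (R.isBWords.gamma.code, codeWord p, codeWord q) = true ↔
      R.isBWords.gamma.Equal p q) {N : ℕ} {U : R.Word} (hU : U.length ≤ N) {v : List ℕ} :
    (v ∈ words R.S.n N ∧ RewriteStep (words R.S.n N)
      (ruleTable O (List.ofFn fun i => codeWord (R.S.rel i))
        (List.ofFn fun j => codeWord (R.C j)) N) (codeWord U) v) ↔
      ∃ V, R.BasicStep U V ∧ codeWord V = v := by
  constructor
  · rintro ⟨-, t, ht, x, hx, y, hy, e, rfl, hl⟩
    obtain ⟨p, q, hp, hq, hpq, rfl⟩ := (mem_ruleTable hO).1 ht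
    obtain ⟨P, -, rfl⟩ := mem_words.1 hx
    obtain ⟨Q, -, rfl⟩ := mem_words.1 hy
    simp only [← codeWord_append, length_codeWord] at e hl ⊢
    exact ⟨_, ⟨P, Q, p, q, codeWord_injective e, rfl, hl, hpq⟩, rfl⟩
  · rintro ⟨V, h, rfl⟩
    refine ⟨mem_words.2 ⟨V, h.length_le.trans hU, rfl⟩, ?_⟩
    obtain ⟨P, Q, p, q, rfl, rfl, hl, hpq⟩ := h
    have hp := R.isBWords.length_le_flatMap p
    have hq := R.isBWords.length_le_flatMap q
    have hl' := hl
    simp only [List.length_append] at hU hl'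
    refine ⟨_, (mem_ruleTable hO).2 ⟨p, q, by omega, by omega, hpq, rfl⟩, codeWord P,
      mem_words.2 ⟨P, by omega, rfl⟩, codeWord Q, mem_words.2 ⟨Q, by omega, rfl⟩, ?_, ?_, ?_⟩
    · simp only [codeWord_append]
    · simp only [codeWord_append]
    · simpa only [length_codeWord] using hl

theorem reachIn_codeWord_iff
    (hO : ∀ p q, O (R.isBWords.gamma.code, codeWord p, codeWord q) = true ↔
      R.isBWords.gamma.Equal p q) {N : ℕ} {X : R.Word} (hX : X.length ≤ N) {z : List ℕ} :
    ReachIn (RewriteStep (words R.S.n N)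
      (ruleTable O (List.ofFn fun i => codeWord (R.S.rel i))
        (List.ofFn fun j => codeWord (R.C j)) N)) (words R.S.n N) (codeWord X) z ↔
      ∃ Z, ReflTransGen R.BasicStep X Z ∧ codeWord Z = z := by
  rw [reachIn_iff (mem_words.2 ⟨X, hX, rfl⟩)]
  have hlen : ∀ {Z}, ReflTransGen R.BasicStep X Z → Z.length ≤ N := by
    intro Z h
    induction h with
    | refl => exact hX
    | tail _ h ih => exact h.length_le.trans ih
  constructor
  · intro h
    induction h with
    | refl => exact ⟨X, .refl, rfl⟩
    | tail _ h ih =>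
      obtain ⟨U, hU, rfl⟩ := ih
      obtain ⟨V, hV, rfl⟩ := (rewriteStep_codeWord_iff hO (hlen hU)).1 h
      exact ⟨V, hU.tail hV, rfl⟩
  · rintro ⟨Z, h, rfl⟩
    induction h with
    | refl => exact .refl
    | @tail U V hU h ih =>
      exact ih.tail ((rewriteStep_codeWord_iff hO (hlen hU)).2 ⟨V, h, rfl⟩)

theorem Distinguished.decidedEqual_iff (hR : R.Distinguished)
    (hO : ∀ p q, O (R.isBWords.gamma.code, codeWord p, codeWord q) = true ↔
      R.isBWords.gamma.Equal p q) (X Y : R.Word) :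
    DecidedEqual O (R.code, codeWord X, codeWord Y) ↔ R.S.Equal X Y := by
  rw [hR.equal_iff]
  simp only [DecidedEqual, Joinable, code, length_codeWord,
    reachIn_codeWord_iff hO (Nat.le_add_right X.length Y.length),
    reachIn_codeWord_iff hO (Nat.le_add_left Y.length X.length), ← hR.mem_descendants_iff]
  constructor
  · rintro ⟨z, -, ⟨Z, hZ, rfl⟩, Z', hZ', e⟩
    obtain rfl := codeWord_injective e
    exact ⟨Z', hZ, hZ'⟩
  · rintro ⟨Z, hZ, hZ'⟩
    refine ⟨codeWord Z, mem_words.2 ⟨Z, ?_, rfl⟩, ⟨Z, hZ, rfl⟩, Z, hZ', rfl⟩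
    exact (length_le_of_mem_descendants hZ).trans (Nat.le_add_right _ _)

end KLTuple

end Makanin

/-- First part: if the identity problem is decidable in every `(k, ℓ)`-group, then a single
algorithm, given a distinguished `(k, ℓ)`-tuple and two words, decides whether these are equal in
the semigroup of the tuple.  (The hypothesis is only asked for each group separately, which is
implied by the existence of one algorithm for all `(k, ℓ)`-groups.)
Second part: equality of words through their finite sets of descendants. -/
theorem theorem3 (k ℓ : ℕ) :
    ((∀ G : Makanin.KLSemigroup k ℓ, G.IsGroup → G.IdentityProblemDecidable) →
      ∃ f : (ℕ × List (List ℕ) × List (List ℕ)) × List ℕ × List ℕ → Bool,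
        Computable f ∧
        ∀ R : Makanin.KLTuple k ℓ, R.Distinguished → ∀ X Y : R.Word,
          (f (R.code, Makanin.KLTuple.codeWord X, Makanin.KLTuple.codeWord Y) = true ↔
            R.S.Equal X Y)) ∧
    (∀ R : Makanin.KLTuple k ℓ, R.Distinguished →
      (∀ X : R.Word, (R.descendants X).Finite) ∧
      ∀ X Y : R.Word, R.S.Equal X Y ↔ (R.descendants X ∩ R.descendants Y).Nonempty) := by
  refine ⟨fun h => ?_, fun R hR => ⟨R.finite_descendants, fun X Y => hR.equal_iff⟩⟩
  -- With $k$ and $\ell$ fixed, bounding the alphabet by $k\ell$ leaves finitely many groups, among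
  -- them every $\Gamma$.
  obtain ⟨O, hO, hcorrect⟩ := Makanin.KLSemigroup.exists_decision_of_finite
    (𝒢 := {G : Makanin.KLSemigroup k ℓ | G.n ≤ k * ℓ ∧ G.IsGroup})
    ((Makanin.KLSemigroup.finite_setOf_n_le (k * ℓ)).subset fun _ hG => hG.1)
    fun G hG => h G hG.2
  obtain ⟨_, hf⟩ := Makanin.computablePred_decidedEqual hO
  refine ⟨_, hf, fun R hR X Y => ?_⟩
  rw [decide_eq_true_iff]
  exact hR.decidedEqual_iff (hcorrect R.isBWords.gamma ⟨R.s_le, R.isGroup⟩) X Y
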